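/- Let $\tau\in\mathbb C$ with $\operatorname{Im}\tau>0$, let $\theta_1,\dots,\theta_4$ be the Jacobi theta functions with nome $e^{\pi i\tau}$, let $k=\theta_2(0)^2/\theta_3(0)^2$ be the corresponding elliptic modulus, let $\mathrm{sn},\mathrm{cn},\mathrm{dn}$ be the Jacobi elliptic functions of modulus $k$ on $\mathbb C$, $$\mathrm{sn}(x)=\frac{\theta_3(0)\,\theta_1(y)}{\theta_2(0)\,\theta_4(y)},\quad \mathrm{cn}(x)=\frac{\theta_4(0)\,\theta_2(y)}{\theta_2(0)\,\theta_4(y)},\quad \mathrm{dn}(x)=\frac{\theta_4(0)\,\theta_3(y)}{\theta_3(0)\,\theta_4(y)},\qquad y=\frac{x}{\theta_3(0)^2},$$ and let $\sqrt k$ be either square root of $k$. For $\gamma_e,\gamma_o,z_0\in\mathbb C$ consider the difference equation $$\begin{aligned}&\mathrm{cn}(\gamma_n)\,\mathrm{dn}(\gamma_n)\bigl(1-k^2\mathrm{sn}^4(z_n)\bigr)u_n(u_{n+1}+u_{n-1})\\&-\mathrm{cn}(z_n)\,\mathrm{dn}(z_n)\bigl(1-k^2\mathrm{sn}^2(z_n)\mathrm{sn}^2(\gamma_n)\bigr)(u_{n+1}u_{n-1}+u_n^2)\\&+\bigl(\mathrm{cn}^2(z_n)-\mathrm{cn}^2(\gamma_n)\bigr)\mathrm{cn}(z_n)\,\mathrm{dn}(z_n)\bigl(1+k^2u_n^2u_{n+1}u_{n-1}\bigr)=0\end{aligned}\tag{1}$$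 for $n\in\mathbb Z$, where $z_n=(\gamma_e+\gamma_o)n+z_0$, and $\gamma_n=\gamma_e$ for even $n$, $\gamma_n=\gamma_o$ for odd $n$. Let $\alpha_0,\beta_0,\phi\in\mathbb C$ and put $\alpha_n=\alpha_0+n\phi$, $\beta_m=\beta_0-m\phi$ for $n,m\in\mathbb Z$. For $\xi_0\in\mathbb C$ and $n\in\mathbb Z$ let $$v_{n,n}=\sqrt k\,\mathrm{sn}\bigl(\xi_0+n(\alpha_0-\beta_0)+n(n-1)\phi\bigr),\qquad v_{n,n+1}=\sqrt k\,\mathrm{sn}\bigl(\xi_0-\beta_0+n(\alpha_0-\beta_0)+n^2\phi\bigr).$$ Then: 1. For all $n\in\mathbb Z$, $v_{n,n}=\sqrt k\,\mathrm{sn}\bigl(\xi_0+\sum_{j=0}^{n-1}\alpha_j-\sum_{j=0}^{n-1}\beta_j\bigr)$ and $v_{n,n+1}=\sqrt k\,\mathrm{sn}\bigl(\xi_0+\sum_{j=0}^{n-1}\alpha_j-\sum_{j=0}^{n}\beta_j\bigr)$, where $\sum_{j=0}^{n-1}=-\sum_{j=n}^{-1}$ for $n<0$. 2. For every $\xi_0\in\mathbb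 C$ the sequence $(u_{2n},u_{2n+1})=\bigl(v_{n,n+1}/\sqrt k,\;v_{n+1,n+1}/\sqrt k\bigr)$, $n\in\mathbb Z$, solves (1) with $z_0=(\alpha_0-\beta_0)/2$, $\gamma_e=(\alpha_0+\beta_0)/2$, $\gamma_o=(\phi-\alpha_0-\beta_0)/2$. 3. Equivalently (after a shift of the index by one), for every $\xi_0\in\mathbb C$ the sequence $(u_{2n},u_{2n+1})=\bigl(v_{n,n}/\sqrt k,\;v_{n,n+1}/\sqrt k\bigr)$, $n\in\mathbb Z$, solves (1) with $z_0=(\alpha_0-\beta_0-\phi)/2$, $\gamma_e=(\phi-\alpha_0-\beta_0)/2$, $\gamma_o=(\alpha_0+\beta_0)/2$. 4. These solutions form a genuine one-parameter family: for every index $j$, the value $u_j$ of the solution in 2 is a non-constant function of $\xi_0$. Here "solves (1)" means that (1) holds at every $n\in\mathbb Z$ at which all its terms are finite, that is, for which neither $z_n$, $\gamma_n$ nor the arguments of $\mathrm{sn}$ in $u_{n-1},u_n,u_{n+1}$ are poles of $\mathrm{sn}$. -/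

import Mathlib

/-! ## Theta functions and Jacobi elliptic functions

The four theta functions with variable `π z` and nome `exp (π i τ)`, in the normalisation of
Whittaker and Watson, written through Mathlib's `jacobiTheta₂ z τ = ∑ exp (2 π i n z + π i n² τ)`.
-/

/-- `θ₃(π z | τ)`. -/
noncomputable def theta3 (τ z : ℂ) : ℂ := jacobiTheta₂ z τ

/-- `θ₄(π z | τ)`. -/
noncomputable def theta4 (τ z : ℂ) : ℂ := jacobiTheta₂ (z + 1 / 2) τ

/-- `θ₂(π z | τ)`. -/
noncomputable def theta2 (τ z : ℂ) : ℂ :=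
  Complex.exp (Real.pi * Complex.I * τ / 4 + Real.pi * Complex.I * z) * jacobiTheta₂ (z + τ / 2) τ

/-- `θ₁(π z | τ)`. -/
noncomputable def theta1 (τ z : ℂ) : ℂ :=
  -Complex.I * Complex.exp (Real.pi * Complex.I * τ / 4 + Real.pi * Complex.I * z) *
    jacobiTheta₂ (z + τ / 2 + 1 / 2) τ

/-- The elliptic modulus `k = θ₂(0)² / θ₃(0)²`. -/
noncomputable def ellipticModulus (τ : ℂ) : ℂ := theta2 τ 0 ^ 2 / theta3 τ 0 ^ 2

/-- The theta-function variable `x / (π θ₃(0)²)` that belongs to the argument `x` of `sn`. -/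
noncomputable def thetaArg (τ x : ℂ) : ℂ := x / (Real.pi * theta3 τ 0 ^ 2)

/-- The Jacobi elliptic function `sn (x, k)`, with `k = ellipticModulus τ`. -/
noncomputable def jacobiSn (τ x : ℂ) : ℂ :=
  theta3 τ 0 / theta2 τ 0 * (theta1 τ (thetaArg τ x) / theta4 τ (thetaArg τ x))

/-- The Jacobi elliptic function `cn (x, k)`, with `k = ellipticModulus τ`. -/
noncomputable def jacobiCn (τ x : ℂ) : ℂ :=
  theta4 τ 0 / theta2 τ 0 * (theta2 τ (thetaArg τ x) / theta4 τ (thetaArg τ x))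

/-- The Jacobi elliptic function `dn (x, k)`, with `k = ellipticModulus τ`. -/
noncomputable def jacobiDn (τ x : ℂ) : ℂ :=
  theta4 τ 0 / theta3 τ 0 * (theta3 τ (thetaArg τ x) / theta4 τ (thetaArg τ x))

/-- `x` is not one of the common poles of `sn`, `cn` and `dn`; these are the zeros of the
denominator `θ₄` (at which the numerators do not vanish). -/
def NotPole (τ x : ℂ) : Prop := theta4 τ (thetaArg τ x) ≠ 0

/-! ## The difference equation -/

/-- `z_n = (γ_e + γ_o) n + z_0`. -/
def rcgZ (γe γo z₀ : ℂ) (n : ℤ) : ℂ := (γe + γo) * n + z₀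

/-- `γ_n = γ_e` for even `n`, and `γ_n = γ_o` for odd `n`. -/
def rcgGamma (γe γo : ℂ) (n : ℤ) : ℂ := if Even n then γe else γo

/-- The elliptic difference equation for `u` at the site `n`, with modulus `k = ellipticModulus τ`
and parameters `γ_e`, `γ_o`, `z_0`. -/
def RCGAt (τ γe γo z₀ : ℂ) (u : ℤ → ℂ) (n : ℤ) : Prop :=
  let k := ellipticModulus τ
  let z := rcgZ γe γo z₀ n
  let γ := rcgGamma γe γo n
  jacobiCn τ γ * jacobiDn τ γ * (1 - k ^ 2 * jacobiSn τ z ^ 4) * u n * (u (n + 1) + u (n - 1))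
    - jacobiCn τ z * jacobiDn τ z * (1 - k ^ 2 * jacobiSn τ z ^ 2 * jacobiSn τ γ ^ 2)
      * (u (n + 1) * u (n - 1) + u n ^ 2)
    + (jacobiCn τ z ^ 2 - jacobiCn τ γ ^ 2) * jacobiCn τ z * jacobiDn τ z
      * (1 + k ^ 2 * u n ^ 2 * u (n + 1) * u (n - 1)) = 0

/-- The sequence `u`, whose entry `u j` is a multiple of `sn` at the argument `x j`, solves the
difference equation at every site `n` at which all the elliptic functions that occur
(`sn`, `cn`, `dn` at `z_n` and `γ_n`, and the values `u_{n-1}`, `u_n`, `u_{n+1}`) are finite. -/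
def SolvesRCG (τ γe γo z₀ : ℂ) (x u : ℤ → ℂ) : Prop :=
  ∀ n : ℤ, NotPole τ (rcgZ γe γo z₀ n) → NotPole τ (rcgGamma γe γo n) →
    NotPole τ (x (n - 1)) → NotPole τ (x n) → NotPole τ (x (n + 1)) →
    RCGAt τ γe γo z₀ u n

/-! ## The singular solution along the diagonal staircase -/

/-- The sequence `w` with `(w_{2n}, w_{2n+1}) = (f_n, g_n)` for all integers `n`. -/
def interleave (f g : ℤ → ℂ) (j : ℤ) : ℂ := if Even j then f (j / 2) else g (j / 2)

theorem interleave_even (f g : ℤ → ℂ) (n : ℤ) : interleave f g (2 * n) = f n := by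
  simp [interleave]

theorem interleave_odd (f g : ℤ → ℂ) (n : ℤ) : interleave f g (2 * n + 1) = g n := by
  have h : (2 * n + 1) / 2 = n := by omega
  simp [interleave, h]

/-- `∑_{j=0}^{n-1} f_j` for every integer `n`, with the usual convention
`∑_{j=0}^{n-1} f_j = - ∑_{j=n}^{-1} f_j` for negative `n`. -/
noncomputable def intSum (f : ℤ → ℂ) (n : ℤ) : ℂ := ∑ j ∈ Finset.Ico 0 n, f j - ∑ j ∈ Finset.Ico n 0, f j

/-- `ξ₀ + n (a - b) + n (n - 1) φ`, the argument of `sn` at the vertex `(n, n)`. -/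
def diagArg (ξ₀ a b φ : ℂ) (n : ℤ) : ℂ := ξ₀ + n * (a - b) + n * (n - 1) * φ

/-- `ξ₀ - b + n (a - b) + n² φ`, the argument of `sn` at the vertex `(n, n + 1)`. -/
def offArg (ξ₀ a b φ : ℂ) (n : ℤ) : ℂ := ξ₀ - b + n * (a - b) + (n : ℂ) ^ 2 * φ

/-- `v_{n,n} = √k sn (ξ₀ + n (a - b) + n (n - 1) φ)`; `s` stands for `√k`. -/
noncomputable def vDiag (τ s ξ₀ a b φ : ℂ) (n : ℤ) : ℂ := s * jacobiSn τ (diagArg ξ₀ a b φ n)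

/-- `v_{n,n+1} = √k sn (ξ₀ - b + n (a - b) + n² φ)`; `s` stands for `√k`. -/
noncomputable def vOff (τ s ξ₀ a b φ : ℂ) (n : ℤ) : ℂ := s * jacobiSn τ (offArg ξ₀ a b φ n)

/-- The arguments of `sn` at the vertices of the staircase
`(0, 1), (1, 1), (1, 2), (2, 2), …`, the vertex `(n, n + 1)` having index `2 n`
and `(n + 1, n + 1)` having index `2 n + 1`. -/
def stairArg (ξ₀ a b φ : ℂ) : ℤ → ℂ :=
  interleave (offArg ξ₀ a b φ) (fun n => diagArg ξ₀ a b φ (n + 1))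

/-- The identification `(u_{2n}, u_{2n+1}) = (v_{n,n+1} / √k, v_{n+1,n+1} / √k)`. -/
noncomputable def stairU (τ s ξ₀ a b φ : ℂ) : ℤ → ℂ :=
  interleave (fun n => vOff τ s ξ₀ a b φ n / s) (fun n => vDiag τ s ξ₀ a b φ (n + 1) / s)

/-- As `stairArg`, but the vertex `(n, n)` has index `2 n` and `(n, n + 1)` has index `2 n + 1`. -/
def stairArg' (ξ₀ a b φ : ℂ) : ℤ → ℂ :=
  interleave (diagArg ξ₀ a b φ) (offArg ξ₀ a b φ)

/-- The identification `(u_{2n}, u_{2n+1}) = (v_{n,n} / √k, v_{n,n+1} / √k)`. -/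
noncomputable def stairU' (τ s ξ₀ a b φ : ℂ) : ℤ → ℂ :=
  interleave (fun n => vDiag τ s ξ₀ a b φ n / s) (fun n => vOff τ s ξ₀ a b φ n / s)

/-! Along the staircase the arguments `x n` of sn satisfy x_{n±1} = x_n + γ_n ± z_n, so u_{n+1} and
u_{n-1} are sn(w + z) and sn(w - z) with the common midpoint w = x_n + γ_n. The addition theorems
express the product and the sum of these two values through sn w and z. The values sn x and sn w are
in turn tied by Euler's symmetric biquadratic with parameter γ. Eliminating w gives the difference
equation at one site (`staircase_identity`, `jacobiSn_staircase`); the rest is arithmetic of the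
arguments.

Everything about sn, cn, dn is derived from theta functions. Splitting a double theta series by
parity turns products at τ into products at 2τ (`jacobiTheta₂_mul_jacobiTheta₂`), after which each
quadratic theta relation is a polynomial identity. The theta constants may be divided by because the
vanishing of one would make two theta functions with opposite multipliers proportional. -/

/-! ## Product formulas for theta functions -/

section ThetaProducts

open Complex

/-- Pairs of integers, split by the parity of the sum of the two entries. -/
noncomputable def intPairParityEquiv : (ℤ × ℤ) ⊕ (ℤ × ℤ) ≃ ℤ × ℤ :=
  Equiv.ofBijective
    (Sum.elim (fun p => (p.1 + p.2, p.1 - p.2)) (fun p => (p.1 + p.2 + 1, p.1 - p.2))) <| by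
    constructor
    · rintro (⟨a, b⟩ | ⟨a, b⟩) (⟨c, d⟩ | ⟨c, d⟩) h <;>
        simp only [Sum.elim_inl, Sum.elim_inr, Prod.mk.injEq] at h
      · rw [show a = c by omega, show b = d by omega]
      · omega
      · omega
      · rw [show a = c by omega, show b = d by omega]
    · rintro ⟨m, n⟩
      rcases Int.even_or_odd' (m + n) with ⟨c, h | h⟩
      · exact ⟨Sum.inl (c, c - n), by simp; omega⟩
      · exact ⟨Sum.inr (c, c - n), by simp; omega⟩

theorem intPairParityEquiv_inl (p : ℤ × ℤ) :
    intPairParityEquiv (Sum.inl p) = (p.1 + p.2, p.1 - p.2) := rfl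

theorem intPairParityEquiv_inr (p : ℤ × ℤ) :
    intPairParityEquiv (Sum.inr p) = (p.1 + p.2 + 1, p.1 - p.2) := rfl

theorem HasSum.int_mul_int {f g : ℤ → ℂ} {a b : ℂ} (hf : HasSum f a) (hg : HasSum g b) :
    HasSum (fun p : ℤ × ℤ => f p.1 * g p.2) (a * b) :=
  hf.mul hg (summable_mul_of_summable_norm hf.summable.norm hg.summable.norm)

theorem hasSum_jacobiTheta₂_term_mul {τ : ℂ} (hτ : 0 < τ.im) (x y : ℂ) :
    HasSum (fun p : ℤ × ℤ => jacobiTheta₂_term p.1 x τ * jacobiTheta₂_term p.2 y τ)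
      (jacobiTheta₂ x τ * jacobiTheta₂ y τ) :=
  HasSum.int_mul_int (f := fun n => jacobiTheta₂_term n x τ)
    (g := fun n => jacobiTheta₂_term n y τ) (hasSum_jacobiTheta₂_term x hτ)
    (hasSum_jacobiTheta₂_term y hτ)

/-- With m = a + b, n = a - b one has m² + n² = 2(a² + b²), so the double series factors again at
2τ. The pairs with m + n odd give the terms shifted by τ. -/
theorem jacobiTheta₂_mul_jacobiTheta₂ {τ : ℂ} (hτ : 0 < τ.im) (x y : ℂ) :
    jacobiTheta₂ x τ * jacobiTheta₂ y τ =
      jacobiTheta₂ (x + y) (2 * τ) * jacobiTheta₂ (x - y) (2 * τ) +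
      cexp (Real.pi * I * τ + 2 * Real.pi * I * x) *
        (jacobiTheta₂ (x + y + τ) (2 * τ) * jacobiTheta₂ (x - y + τ) (2 * τ)) := by
  have hτ2 : 0 < (2 * τ).im := by simpa using hτ
  have h := intPairParityEquiv.hasSum_iff.mpr (hasSum_jacobiTheta₂_term_mul hτ x y)
  refine h.unique (HasSum.sum ?_ ?_)
  · convert hasSum_jacobiTheta₂_term_mul hτ2 (x + y) (x - y) using 2 with p
    simp only [Function.comp_apply, intPairParityEquiv_inl, jacobiTheta₂_term, ← Complex.exp_add]
    congr 1
    push_cast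
    ring
  · refine Eq.subst (motive := fun F => HasSum F _) (funext fun p => ?_)
      ((hasSum_jacobiTheta₂_term_mul hτ2 (x + y + τ) (x - y + τ)).mul_left
        (cexp (Real.pi * I * τ + 2 * Real.pi * I * x)))
    simp only [Function.comp_apply, intPairParityEquiv_inr, jacobiTheta₂_term, ← Complex.exp_add]
    congr 1
    push_cast
    ring

theorem theta3_add_one (τ z : ℂ) : theta3 τ (z + 1) = theta3 τ z := jacobiTheta₂_add_left z τ

theorem theta4_add_one (τ z : ℂ) : theta4 τ (z + 1) = theta4 τ z := by
  rw [theta4, theta4, ← jacobiTheta₂_add_left (z + 1 / 2)]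
  ring_nf

theorem theta2_add_one (τ z : ℂ) : theta2 τ (z + 1) = -theta2 τ z := by
  have h : (Real.pi * I * τ / 4 + Real.pi * I * (z + 1) : ℂ) =
    Real.pi * I * τ / 4 + Real.pi * I * z + Real.pi * I := by ring
  rw [theta2, theta2, h, Complex.exp_add _ (Real.pi * I : ℂ), Complex.exp_pi_mul_I,
    show z + 1 + τ / 2 = z + τ / 2 + 1 by ring, jacobiTheta₂_add_left]
  ring

theorem theta1_eq (τ z : ℂ) : theta1 τ z = -theta2 τ (z + 1 / 2) := by
  have h : (Real.pi * I * τ / 4 + Real.pi * I * (z + 1 / 2) : ℂ) =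
    Real.pi * I * τ / 4 + Real.pi * I * z + Real.pi / 2 * I := by ring
  rw [theta1, theta2, h, Complex.exp_add _ (Real.pi / 2 * I : ℂ), Complex.exp_pi_div_two_mul_I,
    show z + 1 / 2 + τ / 2 = z + τ / 2 + 1 / 2 by ring]
  ring

theorem theta1_add_one (τ z : ℂ) : theta1 τ (z + 1) = -theta1 τ z := by
  rw [theta1_eq, theta1_eq, show z + 1 + 1 / 2 = z + 1 / 2 + 1 by ring, theta2_add_one]

theorem theta4_eq (τ z : ℂ) : theta4 τ z = theta3 τ (z + 1 / 2) := rfl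

/-- The factor by which theta functions change, up to sign, under translation by `τ`. -/
noncomputable def thetaMultiplier (τ z : ℂ) : ℂ := cexp (-Real.pi * I * (τ + 2 * z))

theorem theta2_add_tau (τ z : ℂ) : theta2 τ (z + τ) = thetaMultiplier τ z * theta2 τ z := by
  rw [theta2, theta2, thetaMultiplier, show z + τ + τ / 2 = z + τ / 2 + τ by ring,
    jacobiTheta₂_add_left', ← mul_assoc, ← mul_assoc, ← Complex.exp_add, ← Complex.exp_add]
  congr 2
  ring

theorem theta1_add_tau (τ z : ℂ) : theta1 τ (z + τ) = -thetaMultiplier τ z * theta1 τ z := by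
  rw [theta1_eq, theta1_eq, show z + τ + 1 / 2 = z + 1 / 2 + τ by ring, theta2_add_tau,
    thetaMultiplier, thetaMultiplier,
    show (-Real.pi * I * (τ + 2 * (z + 1 / 2)) : ℂ) =
      -Real.pi * I * (τ + 2 * z) - Real.pi * I by ring,
    Complex.exp_sub, Complex.exp_pi_mul_I]
  ring

variable {τ : ℂ}

theorem theta3_mul_theta3 (hτ : 0 < τ.im) (x y : ℂ) :
    theta3 τ x * theta3 τ y = theta3 (2 * τ) (x + y) * theta3 (2 * τ) (x - y) +
      theta2 (2 * τ) (x + y) * theta2 (2 * τ) (x - y) := by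
  simp only [theta3, theta2, jacobiTheta₂_mul_jacobiTheta₂ hτ x y]
  rw [mul_mul_mul_comm (cexp _), ← Complex.exp_add]
  ring_nf

theorem theta4_mul_theta4 (hτ : 0 < τ.im) (x y : ℂ) :
    theta4 τ x * theta4 τ y = theta3 (2 * τ) (x + y) * theta3 (2 * τ) (x - y) -
      theta2 (2 * τ) (x + y) * theta2 (2 * τ) (x - y) := by
  rw [theta4_eq, theta4_eq, theta3_mul_theta3 hτ,
    show x + 1 / 2 + (y + 1 / 2) = x + y + 1 by ring,
    show x + 1 / 2 - (y + 1 / 2) = x - y by ring, theta3_add_one, theta2_add_one]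
  ring

theorem theta2_mul_theta2 (hτ : 0 < τ.im) (x y : ℂ) :
    theta2 τ x * theta2 τ y = theta2 (2 * τ) (x + y) * theta3 (2 * τ) (x - y) +
      theta3 (2 * τ) (x + y) * theta2 (2 * τ) (x - y) := by
  simp only [theta3, theta2]
  rw [mul_mul_mul_comm (cexp _), jacobiTheta₂_mul_jacobiTheta₂ hτ,
    show x + τ / 2 + (y + τ / 2) = x + y + τ by ring,
    show x + τ / 2 - (y + τ / 2) = x - y by ring,
    show x + y + τ + τ = x + y + 2 * τ by ring, jacobiTheta₂_add_left', mul_add]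
  have h₁ : cexp (Real.pi * I * τ / 4 + Real.pi * I * x) *
      cexp (Real.pi * I * τ / 4 + Real.pi * I * y) =
      cexp (Real.pi * I * (2 * τ) / 4 + Real.pi * I * (x + y)) := by
    rw [← Complex.exp_add]
    ring_nf
  have h₂ : cexp (Real.pi * I * (2 * τ) / 4 + Real.pi * I * (x + y)) *
      cexp (Real.pi * I * τ + 2 * Real.pi * I * (x + τ / 2)) *
      cexp (-Real.pi * I * (2 * τ + 2 * (x + y))) =
      cexp (Real.pi * I * (2 * τ) / 4 + Real.pi * I * (x - y)) := by
    rw [← Complex.exp_add, ← Complex.exp_add]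
    ring_nf
  rw [h₁, mul_div_cancel_left₀ τ two_ne_zero]
  linear_combination jacobiTheta₂ (x + y) (2 * τ) * jacobiTheta₂ (x - y + τ) (2 * τ) * h₂

theorem theta1_mul_theta1 (hτ : 0 < τ.im) (x y : ℂ) :
    theta1 τ x * theta1 τ y = theta3 (2 * τ) (x + y) * theta2 (2 * τ) (x - y) -
      theta2 (2 * τ) (x + y) * theta3 (2 * τ) (x - y) := by
  rw [theta1_eq, theta1_eq, neg_mul_neg, theta2_mul_theta2 hτ,
    show x + 1 / 2 + (y + 1 / 2) = x + y + 1 by ring,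
    show x + 1 / 2 - (y + 1 / 2) = x - y by ring, theta3_add_one, theta2_add_one]
  ring

/-- The theta series over `ℤ + 1 / 4`, at the parameter `2 τ`. -/
noncomputable def thetaQuarter (τ z : ℂ) : ℂ :=
  cexp (Real.pi * I * τ / 8 + Real.pi * I * z / 2) * jacobiTheta₂ (z + τ / 2) (2 * τ)

theorem thetaQuarter_add_one (τ z : ℂ) : thetaQuarter τ (z + 1) = I * thetaQuarter τ z := by
  have h : (Real.pi * I * τ / 8 + Real.pi * I * (z + 1) / 2 : ℂ) =
    Real.pi * I * τ / 8 + Real.pi * I * z / 2 + Real.pi / 2 * I := by ring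
  rw [thetaQuarter, thetaQuarter, h, Complex.exp_add _ (Real.pi / 2 * I : ℂ),
    Complex.exp_pi_div_two_mul_I, show z + 1 + τ / 2 = z + τ / 2 + 1 by ring,
    jacobiTheta₂_add_left]
  ring

theorem thetaQuarter_neg_add_one (τ z : ℂ) :
    thetaQuarter τ (-(z + 1)) = -I * thetaQuarter τ (-z) := by
  have h := thetaQuarter_add_one τ (-(z + 1))
  rw [show -(z + 1) + 1 = -z by ring] at h
  rw [h, ← mul_assoc, neg_mul, I_mul_I]
  ring

/-- For m in ℤ + 1/2 and n in ℤ, the numbers (m + n)/2 and (m - n)/2 lie both in ℤ + 1/4 or both in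
ℤ - 1/4. The two classes give the two summands, the second being the first reflected. -/
theorem theta2_mul_theta3 (hτ : 0 < τ.im) (x y : ℂ) :
    theta2 τ x * theta3 τ y = thetaQuarter τ (x + y) * thetaQuarter τ (x - y) +
      thetaQuarter τ (-(x + y)) * thetaQuarter τ (-(x - y)) := by
  have key (X : ℂ) : jacobiTheta₂ (X + τ / 2 + τ) (2 * τ) =
      cexp (-Real.pi * I * (τ + 2 * X)) * jacobiTheta₂ (-X + τ / 2) (2 * τ) := by
    rw [← jacobiTheta₂_neg_left (-X + τ / 2),
      show X + τ / 2 + τ = -(-X + τ / 2) + 2 * τ by ring, jacobiTheta₂_add_left']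
    ring_nf
  simp only [theta3, theta2, thetaQuarter]
  rw [mul_assoc, jacobiTheta₂_mul_jacobiTheta₂ hτ,
    show x + τ / 2 + y = x + y + τ / 2 by ring,
    show x + τ / 2 - y = x - y + τ / 2 by ring, key, key, mul_add]
  have h₁ : cexp (Real.pi * I * τ / 8 + Real.pi * I * (x + y) / 2) *
      cexp (Real.pi * I * τ / 8 + Real.pi * I * (x - y) / 2) =
      cexp (Real.pi * I * τ / 4 + Real.pi * I * x) := by
    rw [← Complex.exp_add]
    ring_nf
  have h₂ : cexp (Real.pi * I * τ / 4 + Real.pi * I * x) *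
      cexp (Real.pi * I * τ + 2 * Real.pi * I * (x + τ / 2)) *
      cexp (-Real.pi * I * (τ + 2 * (x + y))) * cexp (-Real.pi * I * (τ + 2 * (x - y))) =
      cexp (Real.pi * I * τ / 8 + Real.pi * I * (-(x + y)) / 2) *
      cexp (Real.pi * I * τ / 8 + Real.pi * I * (-(x - y)) / 2) := by
    simp only [← Complex.exp_add]
    ring_nf
  linear_combination jacobiTheta₂ (-(x + y) + τ / 2) (2 * τ) *
    jacobiTheta₂ (-(x - y) + τ / 2) (2 * τ) * h₂ -
    jacobiTheta₂ (x + y + τ / 2) (2 * τ) * jacobiTheta₂ (x - y + τ / 2) (2 * τ) * h₁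

theorem theta1_mul_theta4 (hτ : 0 < τ.im) (x y : ℂ) :
    theta1 τ x * theta4 τ y = -I * (thetaQuarter τ (x + y) * thetaQuarter τ (x - y) -
      thetaQuarter τ (-(x + y)) * thetaQuarter τ (-(x - y))) := by
  rw [theta1_eq, theta4_eq, neg_mul, theta2_mul_theta3 hτ,
    show x + 1 / 2 + (y + 1 / 2) = x + y + 1 by ring,
    show x + 1 / 2 - (y + 1 / 2) = x - y by ring, thetaQuarter_add_one,
    thetaQuarter_neg_add_one]
  ring

end ThetaProducts

/-! ## Addition formulas -/

section ThetaAddition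

variable {τ : ℂ}



/-- Passing to 2τ replaces the arguments y + z, y - z by their sum 2y and difference 2z, and a
square at y by values at 2y and 0. Both sides become polynomials in the same theta values at 2τ. The
formulas below rest on the same mechanism. -/
theorem theta4_add_mul_theta4_sub (hτ : 0 < τ.im) (y z : ℂ) :
    theta4 τ 0 ^ 2 * (theta4 τ (y + z) * theta4 τ (y - z)) =
      theta4 τ y ^ 2 * theta4 τ z ^ 2 - theta1 τ y ^ 2 * theta1 τ z ^ 2 := by
  simp only [sq, theta4_mul_theta4 hτ, theta1_mul_theta1 hτ, show y + z + (y - z) = y + y by ring,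
    show y + z - (y - z) = z + z by ring, sub_self, add_zero]
  ring

theorem theta3_add_mul_theta3_sub (hτ : 0 < τ.im) (y z : ℂ) :
    theta3 τ 0 ^ 2 * (theta3 τ (y + z) * theta3 τ (y - z)) =
      theta3 τ y ^ 2 * theta3 τ z ^ 2 + theta1 τ y ^ 2 * theta1 τ z ^ 2 := by
  simp only [sq, theta3_mul_theta3 hτ, theta1_mul_theta1 hτ, show y + z + (y - z) = y + y by ring,
    show y + z - (y - z) = z + z by ring, sub_self, add_zero]
  ring

theorem theta2_add_mul_theta2_sub (hτ : 0 < τ.im) (y z : ℂ) :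
    theta2 τ 0 ^ 2 * (theta2 τ (y + z) * theta2 τ (y - z)) =
      theta2 τ y ^ 2 * theta2 τ z ^ 2 - theta1 τ y ^ 2 * theta1 τ z ^ 2 := by
  simp only [sq, theta2_mul_theta2 hτ, theta1_mul_theta1 hτ, show y + z + (y - z) = y + y by ring,
    show y + z - (y - z) = z + z by ring, sub_self, add_zero]
  ring

theorem theta1_add_mul_theta1_sub (hτ : 0 < τ.im) (y z : ℂ) :
    theta4 τ 0 ^ 2 * (theta1 τ (y + z) * theta1 τ (y - z)) =
      theta1 τ y ^ 2 * theta4 τ z ^ 2 - theta4 τ y ^ 2 * theta1 τ z ^ 2 := by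
  simp only [sq, theta4_mul_theta4 hτ, theta1_mul_theta1 hτ, show y + z + (y - z) = y + y by ring,
    show y + z - (y - z) = z + z by ring, sub_self, add_zero]
  ring

theorem theta4_zero_sq_mul_theta2_sq (hτ : 0 < τ.im) (z : ℂ) :
    theta4 τ 0 ^ 2 * theta2 τ z ^ 2 =
      theta2 τ 0 ^ 2 * theta4 τ z ^ 2 - theta3 τ 0 ^ 2 * theta1 τ z ^ 2 := by
  simp only [sq, theta4_mul_theta4 hτ, theta3_mul_theta3 hτ, theta2_mul_theta2 hτ,
    theta1_mul_theta1 hτ, sub_self, add_zero]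
  ring

theorem theta1_mul_theta4_add_theta1_mul_theta4 (hτ : 0 < τ.im) (y z : ℂ) :
    theta2 τ 0 * theta3 τ 0 *
        (theta1 τ (y + z) * theta4 τ (y - z) + theta1 τ (y - z) * theta4 τ (y + z)) =
      2 * (theta1 τ y * theta4 τ y) * (theta2 τ z * theta3 τ z) := by
  simp only [theta2_mul_theta3 hτ, theta1_mul_theta4 hτ, sub_self, add_zero, neg_zero,
    show y + z + (y - z) = y + y by ring, show y + z - (y - z) = z + z by ring,
    show y - z + (y + z) = y + y by ring, show y - z - (y + z) = -(z + z) by ring,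
    neg_neg]
  ring

end ThetaAddition

/-! ## Nonvanishing of the theta constants -/

section ThetaConstants

open Complex intervalIntegral

variable {τ : ℂ}

theorem integral_jacobiTheta₂_term (τ : ℂ) (n : ℤ) :
    ∫ x in (0 : ℝ)..1, jacobiTheta₂_term n x τ = if n = 0 then 1 else 0 := by
  rcases eq_or_ne n 0 with rfl | hn
  · simp [jacobiTheta₂_term]
  · have hc : (2 * Real.pi * I * n : ℂ) ≠ 0 :=
      mul_ne_zero two_pi_I_ne_zero (Int.cast_ne_zero.mpr hn)
    simp only [jacobiTheta₂_term, Complex.exp_add, intervalIntegral.integral_mul_const,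
      integral_exp_mul_complex hc, if_neg hn]
    have h : cexp (2 * Real.pi * I * n) = 1 := by
      rw [mul_comm]
      exact Complex.exp_int_mul_two_pi_mul_I n
    simp [h]

/-- The zeroth Fourier coefficient is 1, which shows that the theta function is not identically
zero. -/
theorem integral_jacobiTheta₂ (hτ : 0 < τ.im) :
    ∫ x in (0 : ℝ)..1, jacobiTheta₂ x τ = 1 := by
  have hnorm (n : ℤ) (x : ℝ) : ‖jacobiTheta₂_term n x τ‖ = ‖jacobiTheta₂_term n 0 τ‖ := by
    simp [norm_jacobiTheta₂_term]
  have h := hasSum_integral_of_dominated_convergence (μ := MeasureTheory.volume)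
    (a := 0) (b := 1) (F := fun (n : ℤ) (x : ℝ) => jacobiTheta₂_term n x τ)
    (f := fun x : ℝ => jacobiTheta₂ x τ) (fun n _ => ‖jacobiTheta₂_term n 0 τ‖)
    (fun n => by
      have : Continuous fun x : ℝ => jacobiTheta₂_term n x τ := by
        unfold jacobiTheta₂_term
        fun_prop
      exact this.aestronglyMeasurable)
    (fun n => Filter.Eventually.of_forall fun x _ => (hnorm n x).le)
    (Filter.Eventually.of_forall fun x _ => (hasSum_jacobiTheta₂_term 0 hτ).summable.norm)
    intervalIntegrable_const
    (Filter.Eventually.of_forall fun x _ => hasSum_jacobiTheta₂_term x hτ)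
  simp only [integral_jacobiTheta₂_term] at h
  exact h.unique (hasSum_ite_eq 0 1)

theorem exists_jacobiTheta₂_ne_zero (hτ : 0 < τ.im) : ∃ z, jacobiTheta₂ z τ ≠ 0 := by
  by_contra! h
  simpa [h] using integral_jacobiTheta₂ hτ

theorem exists_theta4_ne_zero (hτ : 0 < τ.im) : ∃ z, theta4 τ z ≠ 0 := by
  obtain ⟨z, hz⟩ := exists_jacobiTheta₂_ne_zero hτ
  exact ⟨z - 1 / 2, by simpa [theta4] using hz⟩

theorem exists_theta2_ne_zero (hτ : 0 < τ.im) : ∃ z, theta2 τ z ≠ 0 := by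
  obtain ⟨z, hz⟩ := exists_jacobiTheta₂_ne_zero hτ
  exact ⟨z - τ / 2, by simpa [theta2, Complex.exp_ne_zero] using hz⟩

theorem differentiable_jacobiTheta₂_fst (hτ : 0 < τ.im) :
    Differentiable ℂ fun z => jacobiTheta₂ z τ :=
  fun z => differentiableAt_jacobiTheta₂_fst z hτ

theorem differentiable_theta4 (hτ : 0 < τ.im) : Differentiable ℂ (theta4 τ) :=
  (differentiable_jacobiTheta₂_fst hτ).comp (differentiable_id.add_const (1 / 2))

theorem differentiable_theta2 (hτ : 0 < τ.im) : Differentiable ℂ (theta2 τ) := by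
  have h := (differentiable_jacobiTheta₂_fst hτ).comp (differentiable_id.add_const (τ / 2))
  exact Differentiable.mul (by fun_prop) h

theorem differentiable_theta1 (hτ : 0 < τ.im) : Differentiable ℂ (theta1 τ) := by
  rw [show theta1 τ = fun z => -theta2 τ (z + 1 / 2) from funext (theta1_eq τ)]
  exact ((differentiable_theta2 hτ).comp (differentiable_id.add_const (1 / 2))).neg

/-- Two entire functions whose squares are proportional cannot have opposite multipliers under a
translation. -/
theorem false_of_sq_mul_sq_eq {f g m : ℂ → ℂ} (hf : Differentiable ℂ f) (hg : Differentiable ℂ g)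
    {c ω z₀ : ℂ} (h : ∀ y z, f y ^ 2 * f z ^ 2 = c ^ 2 * (g y ^ 2 * g z ^ 2)) (hz₀ : f z₀ ≠ 0)
    (hm : m z₀ ≠ 0) (hfm : f (z₀ + ω) = m z₀ * f z₀) (hgm : g (z₀ + ω) = -m z₀ * g z₀) :
    False := by
  obtain ⟨κ, hκ⟩ : ∃ κ, ∀ y, f y ^ 2 = κ ^ 2 * g y ^ 2 := by
    -- Freeze z = z₀ in `h` and divide by f(z₀)².
    refine ⟨c * g z₀ / f z₀, fun y => ?_⟩
    field_simp
    linear_combination h y z₀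
  have contra (d : ℂ) (hd : ∀ y, f y = d * g y) : False := by
    have h₁ := hd (z₀ + ω)
    rw [hfm, hgm] at h₁
    have h₂ : 2 * (m z₀ * f z₀) = 0 := by linear_combination h₁ + m z₀ * hd z₀
    simp_all
  have hadd : Differentiable ℂ fun z => f z + κ * g z := hf.add (hg.const_mul κ)
  have hsub : Differentiable ℂ fun z => f z - κ * g z := hf.sub (hg.const_mul κ)
  -- Since (f + κg)(f - κg) = 0 and entire functions have no zero divisors, f is a constant multiple
  -- of g.
  rcases AnalyticOnNhd.eq_zero_or_eq_zero_of_mul_eq_zero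
    (analyticOnNhd_univ_iff_differentiable.mpr hadd)
    (analyticOnNhd_univ_iff_differentiable.mpr hsub)
    (fun z _ => by linear_combination hκ z) isPreconnected_univ with h | h
  · exact contra (-κ) fun y => by linear_combination h y trivial
  · exact contra κ fun y => by linear_combination h y trivial

/-- If the constant vanished, the left side of the addition formula would too, leaving θ₄(y)²θ₄(z)²
= θ₁(y)²θ₁(z)²; yet translation by 1 fixes θ₄ and negates θ₁. For θ₃ a sign forces c = i. For θ₂,
which is also negated by 1, the translation is τ. -/
theorem theta4_zero_ne_zero (hτ : 0 < τ.im) : theta4 τ 0 ≠ 0 := by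
  intro h0
  obtain ⟨z₀, hz₀⟩ := exists_theta4_ne_zero hτ
  refine false_of_sq_mul_sq_eq (c := 1) (ω := 1) (m := fun _ => 1) (differentiable_theta4 hτ)
    (differentiable_theta1 hτ) (fun y z => ?_) hz₀ one_ne_zero
    (by rw [theta4_add_one, one_mul]) (by rw [theta1_add_one, neg_one_mul])
  have h := theta4_add_mul_theta4_sub hτ y z
  rw [h0] at h
  linear_combination -h

theorem theta3_zero_ne_zero (hτ : 0 < τ.im) : theta3 τ 0 ≠ 0 := by
  intro h0
  obtain ⟨z₀, hz₀⟩ := exists_jacobiTheta₂_ne_zero hτ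
  refine false_of_sq_mul_sq_eq (f := theta3 τ) (c := I) (ω := 1) (m := fun _ => 1)
    (differentiable_jacobiTheta₂_fst hτ)
    (differentiable_theta1 hτ) (fun y z => ?_) hz₀ one_ne_zero
    (by rw [theta3_add_one, one_mul]) (by rw [theta1_add_one, neg_one_mul])
  have h := theta3_add_mul_theta3_sub hτ y z
  rw [h0] at h
  rw [I_sq]
  linear_combination -h

theorem theta2_zero_ne_zero (hτ : 0 < τ.im) : theta2 τ 0 ≠ 0 := by
  intro h0
  obtain ⟨z₀, hz₀⟩ := exists_theta2_ne_zero hτ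
  refine false_of_sq_mul_sq_eq (c := 1) (ω := τ) (m := thetaMultiplier τ)
    (differentiable_theta2 hτ) (differentiable_theta1 hτ) (fun y z => ?_) hz₀
    (Complex.exp_ne_zero _) (theta2_add_tau τ z₀) (theta1_add_tau τ z₀)
  have h := theta2_add_mul_theta2_sub hτ y z
  rw [h0] at h
  linear_combination -h

theorem theta1_zero (hτ : 0 < τ.im) : theta1 τ 0 = 0 := by
  have h := theta1_mul_theta1 hτ 0 0
  rw [add_zero, sub_zero, mul_comm (theta2 (2 * τ) 0), sub_self] at h
  exact mul_self_eq_zero.mp h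

end ThetaConstants

/-! ## The difference equation along a staircase -/

section Staircase

variable {τ : ℂ}

theorem thetaArg_add (τ x y : ℂ) : thetaArg τ (x + y) = thetaArg τ x + thetaArg τ y :=
  add_div _ _ _

theorem thetaArg_sub (τ x y : ℂ) : thetaArg τ (x - y) = thetaArg τ x - thetaArg τ y :=
  sub_div _ _ _

theorem jacobiCn_sq (hτ : 0 < τ.im) {x : ℂ} (hx : NotPole τ x) :
    jacobiCn τ x ^ 2 = 1 - jacobiSn τ x ^ 2 := by
  have h2 := theta2_zero_ne_zero hτ
  have h := theta4_zero_sq_mul_theta2_sq hτ (thetaArg τ x)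
  unfold NotPole at hx
  simp only [jacobiCn, jacobiSn]
  field_simp
  linear_combination h

theorem ellipticModulus_ne_zero (hτ : 0 < τ.im) : ellipticModulus τ ≠ 0 :=
  div_ne_zero (pow_ne_zero 2 (theta2_zero_ne_zero hτ)) (pow_ne_zero 2 (theta3_zero_ne_zero hτ))

/-- The symmetric biquadratic relation between `sn x` and `sn (x + γ)`, the latter in homogeneous
coordinates. -/
theorem theta_biquadratic (hτ : 0 < τ.im) (x γ : ℂ) :
    theta2 τ 0 * theta3 τ 0 * theta1 τ x ^ 2 *
        (theta4 τ (x + γ) ^ 2 * theta4 τ γ ^ 2 - theta1 τ (x + γ) ^ 2 * theta1 τ γ ^ 2) -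
      2 * theta4 τ 0 ^ 2 * (theta1 τ x * theta4 τ x) * (theta1 τ (x + γ) * theta4 τ (x + γ)) *
        (theta2 τ γ * theta3 τ γ) +
      theta2 τ 0 * theta3 τ 0 * theta4 τ x ^ 2 *
        (theta1 τ (x + γ) ^ 2 * theta4 τ γ ^ 2 - theta4 τ (x + γ) ^ 2 * theta1 τ γ ^ 2) = 0 := by
  -- Centred at x + γ, the addition formulas involve x + 2γ and x. In the combination below the
  -- terms containing x + 2γ cancel.
  have h4 := theta4_add_mul_theta4_sub hτ (x + γ) γ
  have h1 := theta1_add_mul_theta1_sub hτ (x + γ) γ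
  have h14 := theta1_mul_theta4_add_theta1_mul_theta4 hτ (x + γ) γ
  rw [add_sub_cancel_right] at h4 h1 h14
  linear_combination -theta2 τ 0 * theta3 τ 0 * theta1 τ x ^ 2 * h4 -
    theta2 τ 0 * theta3 τ 0 * theta4 τ x ^ 2 * h1 +
    theta4 τ 0 ^ 2 * (theta1 τ x * theta4 τ x) * h14

/-- The elimination of the midpoint, as pure algebra. Here κ = θ₃(0)/θ₂(0), the letters U, Up, Um,
σ, g are quotients θ₁/θ₄, and the midpoint enters homogeneously as w₁ : w₄, because x + γ is allowed
to be a pole. -/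
theorem staircase_identity {K : Type*} [Field K] {k κ σ g U Up Um w₁ w₄ Cz Dz Cg Dg : K}
    (hk : k ^ 2 * κ ^ 4 = 1) (hD : w₄ ^ 2 - w₁ ^ 2 * σ ^ 2 ≠ 0)
    (hprod : Up * Um * (w₄ ^ 2 - w₁ ^ 2 * σ ^ 2) = w₁ ^ 2 - w₄ ^ 2 * σ ^ 2)
    (hsum : (Up + Um) * (w₄ ^ 2 - w₁ ^ 2 * σ ^ 2) = 2 * w₁ * w₄ * (Cz * Dz))
    (hQ : U ^ 2 * (w₄ ^ 2 - w₁ ^ 2 * g ^ 2) - 2 * U * w₁ * w₄ * (Cg * Dg) +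
      (w₁ ^ 2 - w₄ ^ 2 * g ^ 2) = 0)
    (hC : Cz ^ 2 - Cg ^ 2 = κ ^ 2 * (g ^ 2 - σ ^ 2)) :
    Cg * Dg * (1 - k ^ 2 * (κ * σ) ^ 4) * (κ * U) * (κ * Up + κ * Um) -
        Cz * Dz * (1 - k ^ 2 * (κ * σ) ^ 2 * (κ * g) ^ 2) * (κ * Up * (κ * Um) + (κ * U) ^ 2) +
      (Cz ^ 2 - Cg ^ 2) * Cz * Dz * (1 + k ^ 2 * (κ * U) ^ 2 * (κ * Up) * (κ * Um)) = 0 := by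
  have e₁ : k ^ 2 * (κ * σ) ^ 4 = σ ^ 4 := by linear_combination σ ^ 4 * hk
  have e₂ : k ^ 2 * (κ * σ) ^ 2 * (κ * g) ^ 2 = σ ^ 2 * g ^ 2 := by
    linear_combination σ ^ 2 * g ^ 2 * hk
  have e₃ : k ^ 2 * (κ * U) ^ 2 * (κ * Up) * (κ * Um) = U ^ 2 * (Up * Um) := by
    linear_combination U ^ 2 * (Up * Um) * hk
  rw [e₁, e₂, e₃]
  apply mul_left_cancel₀ hD
  -- Once the product and sum are inserted, what remains is -κ² Cz Dz (1 - σ⁴) times the biquadratic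
  -- `hQ`.
  linear_combination Cz * Dz * (1 + U ^ 2 * (Up * Um)) * (w₄ ^ 2 - w₁ ^ 2 * σ ^ 2) * hC +
    κ ^ 2 * (Cg * Dg) * (1 - σ ^ 4) * U * hsum +
    κ ^ 2 * (-(Cz * Dz) * (1 - σ ^ 2 * g ^ 2) + (g ^ 2 - σ ^ 2) * (Cz * Dz) * U ^ 2) * hprod -
    κ ^ 2 * (Cz * Dz) * (1 - σ ^ 4) * hQ

theorem jacobiSn_staircase (hτ : 0 < τ.im) {x γ z : ℂ} (hz : NotPole τ z) (hγ : NotPole τ γ)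
    (hx : NotPole τ x) (hm : NotPole τ (x + γ - z)) (hp : NotPole τ (x + γ + z)) :
    jacobiCn τ γ * jacobiDn τ γ * (1 - ellipticModulus τ ^ 2 * jacobiSn τ z ^ 4) * jacobiSn τ x *
        (jacobiSn τ (x + γ + z) + jacobiSn τ (x + γ - z)) -
      jacobiCn τ z * jacobiDn τ z *
        (1 - ellipticModulus τ ^ 2 * jacobiSn τ z ^ 2 * jacobiSn τ γ ^ 2) *
        (jacobiSn τ (x + γ + z) * jacobiSn τ (x + γ - z) + jacobiSn τ x ^ 2) +
      (jacobiCn τ z ^ 2 - jacobiCn τ γ ^ 2) * jacobiCn τ z * jacobiDn τ z *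
        (1 + ellipticModulus τ ^ 2 * jacobiSn τ x ^ 2 * jacobiSn τ (x + γ + z) *
          jacobiSn τ (x + γ - z)) = 0 := by
  have h2 := theta2_zero_ne_zero hτ
  have h3 := theta3_zero_ne_zero hτ
  have h4 := theta4_zero_ne_zero hτ
  have hC : jacobiCn τ z ^ 2 - jacobiCn τ γ ^ 2 = (theta3 τ 0 / theta2 τ 0) ^ 2 *
      ((theta1 τ (thetaArg τ γ) / theta4 τ (thetaArg τ γ)) ^ 2 -
        (theta1 τ (thetaArg τ z) / theta4 τ (thetaArg τ z)) ^ 2) := by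
    rw [jacobiCn_sq hτ hz, jacobiCn_sq hτ hγ, jacobiSn, jacobiSn]
    ring
  have hk : ellipticModulus τ ^ 2 * (theta3 τ 0 / theta2 τ 0) ^ 4 = 1 := by
    rw [ellipticModulus]
    field_simp
  have hQ := theta_biquadratic hτ (thetaArg τ x) (thetaArg τ γ)
  have a4 := theta4_add_mul_theta4_sub hτ (thetaArg τ x + thetaArg τ γ) (thetaArg τ z)
  have a1 := theta1_add_mul_theta1_sub hτ (thetaArg τ x + thetaArg τ γ) (thetaArg τ z)
  have a14 :=
    theta1_mul_theta4_add_theta1_mul_theta4 hτ (thetaArg τ x + thetaArg τ γ) (thetaArg τ z)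
  unfold NotPole at hz hγ hx hm hp
  have hS := staircase_identity (Dz := jacobiDn τ z) (Dg := jacobiDn τ γ)
    (U := theta1 τ (thetaArg τ x) / theta4 τ (thetaArg τ x))
    (Up := theta1 τ (thetaArg τ (x + γ + z)) / theta4 τ (thetaArg τ (x + γ + z)))
    (Um := theta1 τ (thetaArg τ (x + γ - z)) / theta4 τ (thetaArg τ (x + γ - z)))
    (w₁ := theta1 τ (thetaArg τ (x + γ))) (w₄ := theta4 τ (thetaArg τ (x + γ)))
    hk ?_ ?_ ?_ ?_ hC
  · exact hS
  all_goals
    simp only [jacobiCn, jacobiDn, thetaArg_add, thetaArg_sub] at hp hm ⊢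
    generalize theta1 τ (thetaArg τ x + thetaArg τ γ) = w₁ at *
    generalize theta4 τ (thetaArg τ x + thetaArg τ γ) = w₄ at *
    generalize theta1 τ (thetaArg τ x + thetaArg τ γ + thetaArg τ z) = p₁ at *
    generalize theta4 τ (thetaArg τ x + thetaArg τ γ + thetaArg τ z) = p₄ at *
    generalize theta1 τ (thetaArg τ x + thetaArg τ γ - thetaArg τ z) = m₁ at *
    generalize theta4 τ (thetaArg τ x + thetaArg τ γ - thetaArg τ z) = m₄ at *
  -- Up to the factor θ₄(z)², the denominator is θ₄(0)² θ₄(x + γ + z) θ₄(x + γ - z), nonzero because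
  -- neither neighbour is a pole.
  · intro h
    have : theta4 τ 0 ^ 2 * (p₄ * m₄) = 0 := by
      field_simp at h
      linear_combination a4 + h
    exact mul_ne_zero (pow_ne_zero 2 h4) (mul_ne_zero hp hm) this
  · field_simp
    linear_combination p₄ * m₄ * a1 - p₁ * m₁ * a4
  · field_simp
    linear_combination theta4 τ 0 ^ 2 * p₄ * m₄ * a14 -
      theta2 τ 0 * theta3 τ 0 * (p₁ * m₄ + m₁ * p₄) * a4
  · field_simp
    linear_combination hQ

theorem solvesRCG_of_step (hτ : 0 < τ.im) {γe γo z₀ : ℂ} {x : ℤ → ℂ}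
    (hp : ∀ n, x (n + 1) = x n + rcgGamma γe γo n + rcgZ γe γo z₀ n)
    (hm : ∀ n, x (n - 1) = x n + rcgGamma γe γo n - rcgZ γe γo z₀ n) :
    SolvesRCG τ γe γo z₀ x fun j => jacobiSn τ (x j) := by
  intro n hz hγ h₁ h₂ h₃
  simp only [RCGAt]
  rw [hm] at h₁
  rw [hp] at h₃
  rw [hp, hm]
  exact jacobiSn_staircase hτ hz hγ h₂ h₁ h₃

theorem interleave_comp (F : ℂ → ℂ) (f g : ℤ → ℂ) :
    interleave (fun n => F (f n)) (fun n => F (g n)) = fun j => F (interleave f g j) := by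
  funext j
  simp only [interleave]
  split_ifs <;> rfl

theorem stairU_eq {s : ℂ} (hs : s ≠ 0) (τ ξ₀ a b φ : ℂ) :
    stairU τ s ξ₀ a b φ = fun j => jacobiSn τ (stairArg ξ₀ a b φ j) := by
  simp only [stairU, stairArg, vOff, vDiag, mul_div_cancel_left₀ _ hs]
  exact interleave_comp (jacobiSn τ) _ _

theorem stairU'_eq {s : ℂ} (hs : s ≠ 0) (τ ξ₀ a b φ : ℂ) :
    stairU' τ s ξ₀ a b φ = fun j => jacobiSn τ (stairArg' ξ₀ a b φ j) := by
  simp only [stairU', stairArg', vOff, vDiag, mul_div_cancel_left₀ _ hs]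
  exact interleave_comp (jacobiSn τ) _ _

theorem rcgGamma_even (γe γo : ℂ) (n : ℤ) : rcgGamma γe γo (2 * n) = γe := by simp [rcgGamma]

theorem rcgGamma_odd (γe γo : ℂ) (n : ℤ) : rcgGamma γe γo (2 * n + 1) = γo := by simp [rcgGamma]

theorem solvesRCG_stairArg (hτ : 0 < τ.im) (ξ₀ a b φ : ℂ) :
    SolvesRCG τ ((a + b) / 2) ((φ - a - b) / 2) ((a - b) / 2) (stairArg ξ₀ a b φ)
      fun j => jacobiSn τ (stairArg ξ₀ a b φ j) := by
  apply solvesRCG_of_step hτ <;> intro n <;> obtain ⟨m, rfl | rfl⟩ := Int.even_or_odd' n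
  · simp only [stairArg, interleave_even, interleave_odd, rcgGamma_even, rcgZ, offArg, diagArg]
    push_cast
    ring
  · rw [show 2 * m + 1 + 1 = 2 * (m + 1) by ring]
    simp only [stairArg, interleave_even, interleave_odd, rcgGamma_odd, rcgZ, offArg, diagArg]
    push_cast
    ring
  · rw [show 2 * m - 1 = 2 * (m - 1) + 1 by ring]
    simp only [stairArg, interleave_even, interleave_odd, rcgGamma_even, rcgZ, offArg, diagArg]
    push_cast
    ring
  · rw [add_sub_cancel_right]
    simp only [stairArg, interleave_even, interleave_odd, rcgGamma_odd, rcgZ, offArg, diagArg]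
    push_cast
    ring

theorem solvesRCG_stairArg' (hτ : 0 < τ.im) (ξ₀ a b φ : ℂ) :
    SolvesRCG τ ((φ - a - b) / 2) ((a + b) / 2) ((a - b - φ) / 2) (stairArg' ξ₀ a b φ)
      fun j => jacobiSn τ (stairArg' ξ₀ a b φ j) := by
  apply solvesRCG_of_step hτ <;> intro n <;> obtain ⟨m, rfl | rfl⟩ := Int.even_or_odd' n
  · simp only [stairArg', interleave_even, interleave_odd, rcgGamma_even, rcgZ, offArg, diagArg]
    push_cast
    ring
  · rw [show 2 * m + 1 + 1 = 2 * (m + 1) by ring]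
    simp only [stairArg', interleave_even, interleave_odd, rcgGamma_odd, rcgZ, offArg, diagArg]
    push_cast
    ring
  · rw [show 2 * m - 1 = 2 * (m - 1) + 1 by ring]
    simp only [stairArg', interleave_even, interleave_odd, rcgGamma_even, rcgZ, offArg, diagArg]
    push_cast
    ring
  · rw [add_sub_cancel_right]
    simp only [stairArg', interleave_even, interleave_odd, rcgGamma_odd, rcgZ, offArg, diagArg]
    push_cast
    ring

end Staircase

/-! ## Sums of the lattice parameters -/

section LatticeSums

theorem intSum_succ (f : ℤ → ℂ) (n : ℤ) : intSum f (n + 1) = intSum f n + f n := by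
  rcases le_or_gt 0 n with hn | hn
  · have h : Finset.Ico 0 (n + 1) = insert n (Finset.Ico 0 n) := by
      ext j
      simp only [Finset.mem_Ico, Finset.mem_insert]
      omega
    rw [intSum, intSum, h, Finset.sum_insert (by simp), Finset.Ico_eq_empty_of_le hn,
      Finset.Ico_eq_empty_of_le (by omega : 0 ≤ n + 1)]
    simp [add_comm]
  · have h : Finset.Ico n 0 = insert n (Finset.Ico (n + 1) 0) := by
      ext j
      simp only [Finset.mem_Ico, Finset.mem_insert]
      omega
    rw [intSum, intSum, h, Finset.sum_insert (by simp), Finset.Ico_eq_empty_of_le hn.le,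
      Finset.Ico_eq_empty_of_le (by omega : n + 1 ≤ 0)]
    simp

theorem intSum_arithmetic {f : ℤ → ℂ} {d : ℂ} (hf : ∀ n : ℤ, f n = f 0 + n * d) (n : ℤ) :
    intSum f n = n * f 0 + n * (n - 1) / 2 * d := by
  induction n with
  | zero => simp [intSum]
  | succ i ih =>
    rw [intSum_succ, ih, hf i]
    push_cast
    ring
  | pred i ih =>
    have h := intSum_succ f (-i - 1)
    rw [sub_add_cancel, ih, hf (-i - 1)] at h
    push_cast at h ⊢
    linear_combination -h

end LatticeSums

/-! ### Dependence on the free parameter -/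

section FreeParameter

variable {τ : ℂ}

theorem thetaArg_mul (hτ : 0 < τ.im) (y : ℂ) :
    thetaArg τ (Real.pi * theta3 τ 0 ^ 2 * y) = y :=
  mul_div_cancel_left₀ y (mul_ne_zero (Complex.ofReal_ne_zero.mpr Real.pi_ne_zero)
    (pow_ne_zero 2 (theta3_zero_ne_zero hτ)))

theorem exists_jacobiSn_ne (hτ : 0 < τ.im) :
    ∃ x y, NotPole τ x ∧ NotPole τ y ∧ jacobiSn τ x ≠ jacobiSn τ y := by
  have h2 := theta2_zero_ne_zero hτ
  have h3 := theta3_zero_ne_zero hτ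
  have e0 : thetaArg τ 0 = 0 := zero_div _
  have e4 : theta4 τ (-1 / 2) = theta3 τ 0 := by rw [theta4_eq]; norm_num
  have e1 : theta1 τ (-1 / 2) = -theta2 τ 0 := by rw [theta1_eq]; norm_num
  -- The second point is minus the quarter period: a half shift turns θ₁, θ₄ into θ₂, θ₃, so sn = -1
  -- there, against sn 0 = 0.
  refine ⟨0, Real.pi * theta3 τ 0 ^ 2 * (-1 / 2), ?_, ?_, ?_⟩
  · rw [NotPole, e0]
    exact theta4_zero_ne_zero hτ
  · rwa [NotPole, thetaArg_mul hτ, e4]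
  · rw [jacobiSn, jacobiSn, e0, thetaArg_mul hτ, e1, e4, theta1_zero hτ]
    field_simp
    norm_num

theorem stairArg_add_left (ξ₀ c a b φ : ℂ) (j : ℤ) :
    stairArg (ξ₀ + c) a b φ j = stairArg ξ₀ a b φ j + c := by
  simp only [stairArg, interleave, offArg, diagArg]
  split_ifs <;> ring

theorem stairArg_surjective (a b φ : ℂ) (j : ℤ) (x : ℂ) : ∃ ξ₀, stairArg ξ₀ a b φ j = x :=
  ⟨0 + (x - stairArg 0 a b φ j), by rw [stairArg_add_left]; ring⟩

end FreeParameter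

/-- Four assertions about `v_{n,n} = vDiag`, `v_{n,n+1} = vOff` with `α_n = α_0 + n φ`,
`β_m = β_0 - m φ` and `s` a square root of the modulus `k`:
the general singular solution (a sum of the lattice parameters) takes this form;
it solves the difference equation with `z_0 = (α_0 - β_0) / 2`, `γ_e = (α_0 + β_0) / 2`,
`γ_o = (φ - α_0 - β_0) / 2` when `(u_{2n}, u_{2n+1}) = (v_{n,n+1}, v_{n+1,n+1}) / √k`;
equivalently, with `z_0`, `γ_e`, `γ_o` shifted by one step,
when `(u_{2n}, u_{2n+1}) = (v_{n,n}, v_{n,n+1}) / √k`;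
and it does depend on the free parameter `ξ₀` (at every site). -/
theorem mainTheorem5 (τ : ℂ) (hτ : 0 < τ.im) (s : ℂ) (hs : s ^ 2 = ellipticModulus τ)
    (α β : ℤ → ℂ) (φ : ℂ)
    (hα : ∀ n : ℤ, α n = α 0 + n * φ) (hβ : ∀ m : ℤ, β m = β 0 - m * φ) :
    (∀ (ξ₀ : ℂ) (n : ℤ),
      s * jacobiSn τ (ξ₀ + intSum α n - intSum β n) = vDiag τ s ξ₀ (α 0) (β 0) φ n ∧
      s * jacobiSn τ (ξ₀ + intSum α n - intSum β (n + 1)) = vOff τ s ξ₀ (α 0) (β 0) φ n) ∧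
    (∀ ξ₀ : ℂ,
      SolvesRCG τ ((α 0 + β 0) / 2) ((φ - α 0 - β 0) / 2) ((α 0 - β 0) / 2)
        (stairArg ξ₀ (α 0) (β 0) φ) (stairU τ s ξ₀ (α 0) (β 0) φ)) ∧
    (∀ ξ₀ : ℂ,
      SolvesRCG τ ((φ - α 0 - β 0) / 2) ((α 0 + β 0) / 2) ((α 0 - β 0 - φ) / 2)
        (stairArg' ξ₀ (α 0) (β 0) φ) (stairU' τ s ξ₀ (α 0) (β 0) φ)) ∧
    (∀ j : ℤ, ∃ ξ₀ ξ₁ : ℂ,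
      NotPole τ (stairArg ξ₀ (α 0) (β 0) φ j) ∧ NotPole τ (stairArg ξ₁ (α 0) (β 0) φ j) ∧
      stairU τ s ξ₀ (α 0) (β 0) φ j ≠ stairU τ s ξ₁ (α 0) (β 0) φ j) := by
  have hs0 : s ≠ 0 := by
    rintro rfl
    exact ellipticModulus_ne_zero hτ (by simpa using hs.symm)
  have hβ' : ∀ m : ℤ, β m = β 0 + m * -φ := fun m => by rw [hβ m]; ring
  refine ⟨fun ξ₀ n => ⟨?_, ?_⟩, fun ξ₀ => ?_, fun ξ₀ => ?_, fun j => ?_⟩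
  · rw [intSum_arithmetic hα, intSum_arithmetic hβ', vDiag, diagArg]
    ring_nf
  -- The φ-coefficients n(n - 1)/2 and n(n + 1)/2 add up to n².
  · rw [intSum_arithmetic hα, intSum_arithmetic hβ', vOff, offArg]
    push_cast
    ring_nf
  · rw [stairU_eq hs0]
    exact solvesRCG_stairArg hτ ξ₀ (α 0) (β 0) φ
  · rw [stairU'_eq hs0]
    exact solvesRCG_stairArg' hτ ξ₀ (α 0) (β 0) φ
  · obtain ⟨x, y, hx, hy, hxy⟩ := exists_jacobiSn_ne hτ
    obtain ⟨ξ₀, rfl⟩ := stairArg_surjective (α 0) (β 0) φ j x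
    obtain ⟨ξ₁, rfl⟩ := stairArg_surjective (α 0) (β 0) φ j y
    refine ⟨ξ₀, ξ₁, hx, hy, ?_⟩
    rw [stairU_eq hs0, stairU_eq hs0]
    exact hxy
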